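/- **Notation.** For elements $\alpha,R$ of a commutative ring and $n\ge 0$ let $p_n(\alpha,R)=\prod_{0\le j<n}(R+\alpha j)$. For an integer $\alpha\ge1$ the $\alpha$-factorial function is defined on the integers by $n!_{(\alpha)}=n\cdot(n-\alpha)!_{(\alpha)}$ if $n>0$, $n!_{(\alpha)}=1$ if $-\alpha<n\le 0$, and $n!_{(\alpha)}=0$ otherwise. Let polynomials $P_h=P_h(\alpha,R;z)$ and $Q_h=Q_h(\alpha,R;z)$ in $z$ be defined by $P_0=0$, $P_1=1$, $Q_0=1$, $Q_1=1-Rz$, where for $h\ge2$ both satisfy $$Y_h=\bigl(1-(R+2\alpha(h-1))z\bigr)Y_{h-1}-\alpha\,(R+\alpha(h-2))\,(h-1)\,z^2\,Y_{h-2}.$$ Put $\widetilde P_h(\alpha,R;z)=z^{h-1}P_h(\alpha,R;z^{-1})$ and $\widetilde Q_h(\alpha,R;z)=z^{h}Q_h(\alpha,R;z^{-1})$ (a monic polynomial of degree $h$ in $z$). Let $K$ be a field of characteristic $0$. For $\alpha,R\in K$ such that $\widetilde Q_h(\alpha,R;z)$ splits over $K$, let $\ell_{h,1},\dots,\ell_{h,h}\in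 K$ be its zeros, with multiplicity, in any fixed order, and let $C_{h,i}=\widetilde P_h(\alpha,R;\ell_{h,i})$; these depend on $(\alpha,R)$. If the zeros are distinct, put for $N\ge 0$ $$S_{h,N}(\alpha,R)=\sum_{i=1}^{h}\frac{C_{h,i}}{\prod_{j\ne i}(\ell_{h,i}-\ell_{h,j})}\;\ell_{h,i}^{\,N}.$$ **Theorem.** 1. Let $h\ge1$ and let $\alpha,R\in K$ be nonzero. As polynomials in $z$, $$\widetilde Q_h(\alpha,R;z)=\alpha^h\,U\!\left(-h,\tfrac R\alpha,\tfrac z\alpha\right)=(-\alpha)^h\,h!\,L_h^{(R/\alpha-1)}\!\left(\tfrac z\alpha\right),$$ where $U(-h,b,w)=(-1)^h\sum_{k=0}^h\binom hk (b+k)_{h-k}(-w)^k$ is the confluent hypergeometric function and $L_h^{(\beta)}(x)=\sum_{k=0}^h\frac{(\beta+k+1)_{h-k}}{(h-k)!}\frac{(-x)^k}{k!}$ is the associated Laguerre polynomial. Hence the $\ell_{h,i}$ are the zeros of these functions of $z$. 2. Let $h\ge1$ and let $\alpha,R\in K$ be nonzero with $\widetilde Q_h$ split over $K$. The zeros $\ell_{h,1},\dots,\ell_{h,h}$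 are distinct if and only if $R+j\alpha\neq0$ for all integers $1\le j<h$. If they are distinct, then for $c_1,\dots,c_h\in K$ the partial fraction expansion $\dfrac{P_h(\alpha,R;z)}{Q_h(\alpha,R;z)}=\sum_{j=1}^h\dfrac{c_j}{1-\ell_{h,j}z}$ holds in $K(z)$ if and only if $c_i=C_{h,i}/\prod_{j\ne i}(\ell_{h,i}-\ell_{h,j})$ for every $i$; thus $S_{h,N}(\alpha,R)=\sum_i c_i\,\ell_{h,i}^{\,N}$. 3. (Generalized products.) Let $\alpha,R\in K$ be nonzero. If $h\ge n\ge1$ and $\widetilde Q_h(\alpha,R;z)$ has $h$ distinct zeros in $K$, then $p_n(\alpha,R)=S_{h,n}(\alpha,R)$. If $p\ge2$ and $n\ge1$ are integers, $\widetilde Q_p(\alpha,R;z)$ has $p$ distinct zeros in $K$, and $A$ is a subring of $K$ containing $\alpha$ and $R$ (for instance $\mathbb Z$ if $\alpha,R$ are integers, or $\mathbb Z[\alpha,R]$ if they are indeterminates), then $S_{p,n}(\alpha,R)\in A$ and $$p_n(\alpha,R)\equiv S_{p,n}(\alpha,R)\pmod{p,\ p\alpha,\ p\alpha^2,\ \dots,\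 p\alpha^p}\quad\text{in } A.$$ 4. ($\alpha$-factorials.) Let $\alpha,n\ge1$ be integers and $N=\lfloor\frac{n-1}{\alpha}\rfloor+1$. If $h\ge n$ and $\widetilde Q_h(-\alpha,n;z)$ has $h$ distinct zeros in $K$, then $n!_{(\alpha)}=S_{h,N}(-\alpha,n)$. If $p\ge2$ and $\widetilde Q_p(-\alpha,n;z)$ has $p$ distinct zeros in $K$, then $S_{p,N}(-\alpha,n)$ is an integer and $$n!_{(\alpha)}\equiv S_{p,N}(-\alpha,n)\pmod{p,\ p\alpha,\ p\alpha^2,\ \dots,\ p\alpha^p}.$$ 5. (Symbolic form, which includes the parameter values at which zeros coincide.) Let $x\in K$ be transcendental over $\mathbb Z$, and let $h,n\ge1$ be integers. (a) Let $\alpha\neq0$ be an integer such that $\widetilde Q_h(\alpha,x;z)$ splits over $K$. Then $S_{h,n}(\alpha,x)=s(x)$ for a polynomial $s$ with integer coefficients such that, for every integer $R$: $p_n(\alpha,R)=s(R)$ if $n\le h$; and, if $h\ge2$, $p_n(\alpha,R)\equiv s(R)$ modulo $h\alpha^i$ for all $0\le i\le h$. (b) Let $\alpha\ge1$ be an integer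 such that $\widetilde Q_h(-\alpha,x;z)$ splits over $K$, and $N=\lfloor\frac{n-1}{\alpha}\rfloor+1$. Then $S_{h,N}(-\alpha,x)=s(x)$ for a polynomial $s$ with integer coefficients such that $n!_{(\alpha)}=s(n)$ if $n\le h$; and, if $h\ge2$, $n!_{(\alpha)}\equiv s(n)$ modulo $h\alpha^i$ for all $0\le i\le h$. -/

import Mathlib

open Polynomial

noncomputable section

namespace GenFact

/-- The generalized product sequence `p_n(α, R) = R (R + α) ⋯ (R + (n - 1) α)`, with `p_0 = 1`. -/
def genProd {A : Type*} [CommRing A] (n : ℕ) (α R : A) : A :=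
  ∏ j ∈ Finset.range n, (R + α * (j : A))

/-- The `α`-factorial function `n!_(α)` of an integer `n`, for an integer `α ≥ 1`: it is
`n * (n - α)!_(α)` if `n > 0`, it is `1` if `-α < n ≤ 0`, and `0` otherwise.
(The condition `0 < α` only serves termination; `α = 0` is never used.) -/
def alphaFactorial (α : ℕ) (n : ℤ) : ℤ :=
  if 0 < n ∧ 0 < α then n * alphaFactorial α (n - α)
  else if -(α : ℤ) < n then 1
  else 0
termination_by n.toNat
decreasing_by omega

/-- The convergent numerators `P_h(α, R; z)`, as polynomials in `z`. -/
def convP {A : Type*} [CommRing A] (α R : A) : ℕ → A[X]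
  | 0 => 0
  | 1 => 1
  | h + 2 =>
      (1 - C (R + 2 * α * ((h : A) + 1)) * X) * convP α R (h + 1)
        - C (α * (R + α * (h : A)) * ((h : A) + 1)) * X ^ 2 * convP α R h

/-- The convergent denominators `Q_h(α, R; z)`, as polynomials in `z`. -/
def convQ {A : Type*} [CommRing A] (α R : A) : ℕ → A[X]
  | 0 => 1
  | 1 => 1 - C R * X
  | h + 2 =>
      (1 - C (R + 2 * α * ((h : A) + 1)) * X) * convQ α R (h + 1)
        - C (α * (R + α * (h : A)) * ((h : A) + 1)) * X ^ 2 * convQ α R h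

/-- The reflected numerator `z^(h-1) P_h(α, R; 1/z)` (for `h ≥ 1`). -/
def reflP {A : Type*} [CommRing A] (h : ℕ) (α R : A) : A[X] :=
  (convP α R h).reflect (h - 1)

/-- The reflected denominator `z^h Q_h(α, R; 1/z)`. -/
def reflQ {A : Type*} [CommRing A] (h : ℕ) (α R : A) : A[X] :=
  (convQ α R h).reflect h

section Field

variable {K : Type*} [Field K]

/-- The `h`-th convergent `P_h(α, R; z) / Q_h(α, R; z)`, a rational function of `z`. -/
def conv (h : ℕ) (α R : K) : RatFunc K :=
  algebraMap K[X] (RatFunc K) (convP α R h) / algebraMap K[X] (RatFunc K) (convQ α R h)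

/-- `ℓ` lists the `h` zeros in `K` of the reflected denominator, with multiplicity, in some order. -/
def IsZeroOrdering (h : ℕ) (α R : K) (ℓ : Fin h → K) : Prop :=
  reflQ h α R = ∏ i, (X - C (ℓ i))

/-- `C_{h,i} / ∏_{j ≠ i} (ℓ_{h,i} - ℓ_{h,j})`, where `C_{h,i}` is the value of the reflected
numerator at the zero `ℓ_{h,i}`. -/
def zeroCoeff (h : ℕ) (α R : K) (ℓ : Fin h → K) (i : Fin h) : K :=
  (reflP h α R).eval (ℓ i) / ∏ j ∈ Finset.univ.erase i, (ℓ i - ℓ j)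

/-- `∑_i C_{h,i} / ∏_{j ≠ i} (ℓ_{h,i} - ℓ_{h,j}) * ℓ_{h,i}^N`. -/
def zeroSum (h : ℕ) (α R : K) (ℓ : Fin h → K) (N : ℕ) : K :=
  ∑ i, zeroCoeff h α R ℓ i * ℓ i ^ N

/-- `c` lists the coefficients of the partial fraction expansion
`P_h / Q_h = ∑_j c_j / (1 - ℓ_j z)`. -/
def IsPartialFractionCoeffs (h : ℕ) (α R : K) (ℓ c : Fin h → K) : Prop :=
  conv h α R = ∑ j, RatFunc.C (c j) / (1 - RatFunc.C (ℓ j) * RatFunc.X)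

/-- The associated Laguerre polynomial
`L_n^(β)(x) = ∑_k (-1)^k binom(n + β, n - k) x^k / k!`, where
`binom(n + β, n - k) = (β + k + 1)_(n - k) / (n - k)!`. -/
def laguerreL (n : ℕ) (β x : K) : K :=
  ∑ k ∈ Finset.range (n + 1),
    (-1) ^ k * ((ascPochhammer K (n - k)).eval (β + k + 1) / ((n - k).factorial : K))
      * x ^ k / (k.factorial : K)

/-- Tricomi's confluent hypergeometric function `U(a, b, w)` at `a = -n`, where it is the polynomial
`(-1)^n ∑_k binom(n, k) (b + k)_(n - k) (-w)^k`. -/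
def hypUNeg (n : ℕ) (b w : K) : K :=
  (-1) ^ n * ∑ k ∈ Finset.range (n + 1),
    (n.choose k : K) * (ascPochhammer K (n - k)).eval (b + k) * (-w) ^ k

end Field

end GenFact

end

noncomputable section
namespace GenFact

/-! ### Convergents of the generating series, over a commutative ring -/

section CommRing

variable {A B : Type*} [CommRing A] [CommRing B]

/-! Everything rests on one identity over an arbitrary commutative ring: with `F = ∑ p_n z^n`, `Q_h
F = P_h + α^h z^h ∑ t(t-1)⋯(t-h+1) p_t z^t` (`convQ_mul_prodSeries`). The remainder's sum starts at
`z^h`, and its falling factorials are multiples of `h!`. Hence `p_n` equals the coefficient of `z^n`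
in `P_h / Q_h` when `n < 2h`, and always agrees with it up to a multiple of `h! α^h`. As `Q_h` has
constant term 1, this coefficient lies in the ground ring; taking `A`, `ℤ` or `ℤ[x]` as ground ring
gives integrality and specialization.

Over a field with distinct zeros, partial fractions and geometric series turn the coefficient into
the sum over zeros (`zeroSum_eq_coeff_convSeries`). Distinctness is read off the closed form
`coeff_convQ`: the ratio of consecutive coefficients gives the Laguerre differential equation, which
forbids repeated nonzero zeros, and the lowest coefficients control the zero at 0. -/

theorem genProd_zero (α R : A) : genProd 0 α R = 1 := by simp [genProd]

theorem genProd_succ (n : ℕ) (α R : A) :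
    genProd (n + 1) α R = genProd n α R * (R + α * n) := by
  simp [genProd, Finset.prod_range_succ]

theorem genProd_succ' (n : ℕ) (α R : A) :
    genProd (n + 1) α R = R * genProd n α (R + α) := by
  simp only [genProd, Finset.prod_range_succ', Nat.cast_zero, mul_zero, add_zero]
  rw [mul_comm]
  congr 1
  refine Finset.prod_congr rfl fun j _ => ?_
  push_cast
  ring

theorem map_genProd (f : A →+* B) (n : ℕ) (α R : A) :
    f (genProd n α R) = genProd n (f α) (f R) := by
  simp [genProd, map_prod]

theorem map_convP (f : A →+* B) (α R : A) (h : ℕ) :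
    (convP α R h).map f = convP (f α) (f R) h := by
  induction h using Nat.twoStepInduction with
  | zero => simp [convP]
  | one => simp [convP]
  | more h ih0 ih1 => simp [convP, ih0, ih1, show f 2 = 2 from map_ofNat f 2]

theorem map_convQ (f : A →+* B) (α R : A) (h : ℕ) :
    (convQ α R h).map f = convQ (f α) (f R) h := by
  induction h using Nat.twoStepInduction with
  | zero => simp [convQ]
  | one => simp [convQ]
  | more h ih0 ih1 => simp [convQ, ih0, ih1, show f 2 = 2 from map_ofNat f 2]

theorem natDegree_three_term_le {a b : A} {p q : A[X]} {n : ℕ}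
    (hp : p.natDegree ≤ n + 1) (hq : q.natDegree ≤ n) :
    ((1 - C a * X) * p - C b * X ^ 2 * q).natDegree ≤ n + 2 := by
  have h1 : (1 - C a * X : A[X]).natDegree ≤ 1 := by compute_degree
  have h2 : (C b * X ^ 2 : A[X]).natDegree ≤ 2 := by compute_degree
  refine (natDegree_sub_le_of_le (natDegree_mul_le_of_le h1 hp)
    (natDegree_mul_le_of_le h2 hq)).trans ?_
  omega

theorem natDegree_convQ_le (α R : A) (h : ℕ) : (convQ α R h).natDegree ≤ h := by
  induction h using Nat.twoStepInduction with
  | zero => simp [convQ]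
  | one => rw [convQ]; compute_degree
  | more h ih0 ih1 => rw [convQ]; exact natDegree_three_term_le ih1 ih0

theorem natDegree_convP_succ_le (α R : A) (h : ℕ) : (convP α R (h + 1)).natDegree ≤ h := by
  induction h using Nat.twoStepInduction with
  | zero => simp [convP]
  | one =>
    rw [convP, convP, convP]
    simp only [mul_zero, sub_zero, mul_one]
    compute_degree
  | more h ih0 ih1 => rw [convP]; exact natDegree_three_term_le ih1 ih0

theorem coeff_zero_convQ (α R : A) (h : ℕ) : (convQ α R h).coeff 0 = 1 := by
  induction h using Nat.twoStepInduction with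
  | zero => simp [convQ]
  | one => simp [convQ]
  | more h ih0 ih1 => simp [convQ, mul_coeff_zero, ih1]

/-- The generating series of the generalized products. -/
def prodSeries (α R : A) : PowerSeries A := PowerSeries.mk fun n => genProd n α R

/-- The series `∑ₜ t (t - 1) ⋯ (t - h + 1) pₜ(α, R) zᵗ`. -/
def fallingSeries (h : ℕ) (α R : A) : PowerSeries A :=
  PowerSeries.mk fun t => (t.descFactorial h : A) * genProd t α R

/-- Multiplied by `α^(h+1) z^(h+1)`, this says that the remainders `α^h z^h fallingSeries h` obey
the recurrence of `P_h` and `Q_h`. -/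
theorem fallingSeries_recurrence (h : ℕ) (α R : A) :
    PowerSeries.C α * PowerSeries.X * fallingSeries (h + 2) α R =
      (1 - PowerSeries.C (R + 2 * α * ((h : A) + 1)) * PowerSeries.X) * fallingSeries (h + 1) α R
      - PowerSeries.C ((R + α * (h : A)) * ((h : A) + 1)) * PowerSeries.X * fallingSeries h α R := by
  ext n
  simp only [sub_mul, one_mul, mul_assoc, map_sub, PowerSeries.coeff_C_mul]
  rcases n with _ | t
  · simp [fallingSeries]
  · simp only [PowerSeries.coeff_succ_X_mul, fallingSeries, PowerSeries.coeff_mk, genProd_succ,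
      Nat.succ_descFactorial_succ]
    -- Subtraction is moved into the ring; for `t < k` both sides vanish.
    have e : ∀ k : ℕ, ((t.descFactorial (k + 1) : ℕ) : A) = ((t : A) - k) * t.descFactorial k := by
      intro k
      rw [Nat.descFactorial_succ]
      rcases le_or_gt k t with hk | hk
      · push_cast [Nat.cast_sub hk]; ring
      · simp [Nat.descFactorial_of_lt hk]
    rw [show h + 2 = h + 1 + 1 from rfl, e (h + 1), e h]
    push_cast
    ring

theorem convQ_mul_prodSeries (h : ℕ) (α R : A) :
    (convQ α R h : PowerSeries A) * prodSeries α R =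
      (convP α R h : PowerSeries A) +
        PowerSeries.C (α ^ h) * PowerSeries.X ^ h * fallingSeries h α R := by
  induction h using Nat.twoStepInduction with
  | zero => simp [convQ, convP, fallingSeries, prodSeries]
  | one =>
    ext n
    rcases n with _ | t
    · simp [convQ, convP, fallingSeries, prodSeries, sub_mul, mul_assoc, genProd_zero]
    · simp [convQ, convP, fallingSeries, prodSeries, sub_mul, mul_assoc, genProd_succ,
        PowerSeries.coeff_one]
      ring
  | more h ih0 ih1 =>
    have key := fallingSeries_recurrence h α R
    simp only [convQ, convP, coe_sub, coe_mul, coe_one, coe_C, coe_X, coe_pow]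
    simp only [map_mul, map_pow] at ih0 ih1 key ⊢
    linear_combination (1 - PowerSeries.C (R + 2 * α * ((h : A) + 1)) * PowerSeries.X) * ih1
      - PowerSeries.C α * PowerSeries.C (R + α * (h : A)) * PowerSeries.C ((h : A) + 1)
        * PowerSeries.X ^ 2 * ih0
      - PowerSeries.C α ^ (h + 1) * PowerSeries.X ^ (h + 1) * key

/-- The power series expansion of the convergent `P_h / Q_h`. -/
def convSeries (h : ℕ) (α R : A) : PowerSeries A :=
  (convP α R h : PowerSeries A) * PowerSeries.invOfUnit (convQ α R h) 1

theorem convQ_mul_invOfUnit (h : ℕ) (α R : A) :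
    (convQ α R h : PowerSeries A) * PowerSeries.invOfUnit (convQ α R h) 1 = 1 :=
  PowerSeries.mul_invOfUnit _ _ (by simp [coeff_zero_convQ])

/-- Division-free characterization, which ring homomorphisms and partial fractions can both be
checked against. -/
theorem eq_convSeries_iff (h : ℕ) (α R : A) (F : PowerSeries A) :
    F = convSeries h α R ↔ (convQ α R h : PowerSeries A) * F = convP α R h := by
  have e := convQ_mul_invOfUnit h α R
  constructor
  · rintro rfl
    rw [convSeries]
    linear_combination (convP α R h : PowerSeries A) * e
  · intro hF
    rw [convSeries]
    linear_combination PowerSeries.invOfUnit (convQ α R h : PowerSeries A) 1 * hF - F * e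

theorem map_convSeries (f : A →+* B) (h : ℕ) (α R : A) :
    PowerSeries.map f (convSeries h α R) = convSeries h (f α) (f R) := by
  rw [eq_convSeries_iff, ← map_convQ, ← map_convP, polynomial_map_coe, polynomial_map_coe,
    ← map_mul, (eq_convSeries_iff h α R _).1 rfl]

theorem map_coeff_convSeries (f : A →+* B) (h n : ℕ) (α R : A) :
    f (PowerSeries.coeff n (convSeries h α R)) =
      PowerSeries.coeff n (convSeries h (f α) (f R)) := by
  rw [← map_convSeries, PowerSeries.coeff_map]

theorem prodSeries_sub_convSeries (h : ℕ) (α R : A) :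
    prodSeries α R - convSeries h α R =
      PowerSeries.C (α ^ h) * (PowerSeries.X ^ h * fallingSeries h α R *
        PowerSeries.invOfUnit (convQ α R h) 1) := by
  have e := convQ_mul_invOfUnit h α R
  have e1 := convQ_mul_prodSeries h α R
  rw [convSeries]
  linear_combination PowerSeries.invOfUnit (convQ α R h : PowerSeries A) 1 * e1
    - prodSeries α R * e

theorem genProd_sub_coeff_convSeries (h n : ℕ) (α R : A) :
    genProd n α R - PowerSeries.coeff n (convSeries h α R) =
      α ^ h * PowerSeries.coeff n (PowerSeries.X ^ h * fallingSeries h α R *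
        PowerSeries.invOfUnit (convQ α R h) 1) := by
  have e := congrArg (PowerSeries.coeff n) (prodSeries_sub_convSeries h α R)
  rwa [map_sub, PowerSeries.coeff_C_mul, prodSeries, PowerSeries.coeff_mk] at e

/-- The falling factorials vanish for `t < h`; with the prefactor `z^h`, the error is divisible by
`z^(2h)`. -/
theorem genProd_eq_coeff_convSeries {h n : ℕ} (hn : n < 2 * h) (α R : A) :
    genProd n α R = PowerSeries.coeff n (convSeries h α R) := by
  rw [← sub_eq_zero, genProd_sub_coeff_convSeries]
  have h1 : (PowerSeries.X : PowerSeries A) ^ h ∣ fallingSeries h α R := by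
    rw [PowerSeries.X_pow_dvd_iff]
    intro m hm
    simp [fallingSeries, Nat.descFactorial_of_lt hm]
  have h2 : (PowerSeries.X : PowerSeries A) ^ (2 * h) ∣ PowerSeries.X ^ h * fallingSeries h α R *
      PowerSeries.invOfUnit (convQ α R h) 1 := by
    rw [two_mul, pow_add]
    exact Dvd.dvd.mul_right (mul_dvd_mul_left _ h1) _
  rw [PowerSeries.X_pow_dvd_iff.1 h2 n hn, mul_zero]

/-- The falling factorial is `h!` times a binomial coefficient, so `h!` comes out of the error along
with `α^h`. -/
theorem factorial_mul_pow_dvd_genProd_sub (h n : ℕ) (α R : A) :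
    (h.factorial : A) * α ^ h ∣ genProd n α R - PowerSeries.coeff n (convSeries h α R) := by
  have e : fallingSeries h α R = PowerSeries.C (h.factorial : A) *
      PowerSeries.mk fun t => (t.choose h : A) * genProd t α R := by
    ext t
    simp only [fallingSeries, PowerSeries.coeff_mk, PowerSeries.coeff_C_mul,
      Nat.descFactorial_eq_factorial_mul_choose]
    push_cast
    ring
  rw [genProd_sub_coeff_convSeries, e, mul_comm _ (α ^ h)]
  refine mul_dvd_mul_left _ ?_
  rw [mul_left_comm, mul_assoc, PowerSeries.coeff_C_mul]
  exact dvd_mul_right _ _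

theorem mul_pow_dvd_genProd_sub {h i : ℕ} (hh : 1 ≤ h) (hi : i ≤ h) (n : ℕ) (α R : A) :
    (h : A) * α ^ i ∣ genProd n α R - PowerSeries.coeff n (convSeries h α R) := by
  refine dvd_trans (mul_dvd_mul ?_ (pow_dvd_pow α hi)) (factorial_mul_pow_dvd_genProd_sub h n α R)
  exact_mod_cast Nat.cast_dvd_cast (α := A) (Nat.dvd_factorial hh le_rfl)

end CommRing

/-- The recursion runs through the positive terms of `n, n - α, n - 2α, …`, which number `⌊(n-1)/α⌋
+ 1`, and stops with value 1 in `(-α, 0]`. -/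
theorem alphaFactorial_eq_genProd {α : ℕ} (hα : 1 ≤ α) {n : ℕ} (hn : 1 ≤ n) :
    alphaFactorial α (n : ℤ) = genProd ((n - 1) / α + 1) (-(α : ℤ)) (n : ℤ) := by
  induction n using Nat.strong_induction_on with
  | _ n ih =>
    rw [alphaFactorial, if_pos ⟨by omega, by omega⟩]
    rcases lt_or_ge α n with h | h
    · have e : ((n : ℤ) - α) = ((n - α : ℕ) : ℤ) := by omega
      rw [e, ih (n - α) (by omega) (by omega)]
      have e2 : (n - 1) / α = (n - α - 1) / α + 1 := by
        rw [← Nat.add_div_right _ (by omega)]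
        congr 1
        omega
      rw [e2, ← e, genProd_succ' (_ + 1), sub_eq_add_neg]
    · rw [alphaFactorial, if_neg (by omega), if_pos (by omega), Nat.div_eq_of_lt (by omega)]
      simp [genProd]


/-! ### Closed form of the denominator and the Laguerre equation -/

section CommRing

variable {A : Type*} [CommRing A]

theorem coeff_convQ (α R : A) (m k : ℕ) :
    (convQ α R (m + k)).coeff k =
      (-1) ^ k * ((m + k).choose k : A) * genProd k α (R + α * m) := by
  -- The recurrence at `h` needs several splittings `m + k`, so these stay quantified in the
  -- induction.
  suffices H : ∀ h m k : ℕ, m + k = h → (convQ α R h).coeff k =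
      (-1) ^ k * (h.choose k : A) * genProd k α (R + α * m) from H _ m k rfl
  intro h
  induction h using Nat.twoStepInduction with
  | zero =>
    intro m k hmk
    obtain ⟨rfl, rfl⟩ : m = 0 ∧ k = 0 := by omega
    simp [convQ, genProd_zero]
  | one =>
    intro m k hmk
    rcases k with _ | k
    · simp [coeff_zero_convQ, genProd_zero]
    · obtain ⟨rfl, rfl⟩ : m = 0 ∧ k = 0 := by omega
      simp [convQ, genProd, coeff_one]
  | more h ih0 ih1 =>
    intro m k hmk
    rcases k with _ | _ | k
    · simp [coeff_zero_convQ, genProd_zero]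
    · obtain rfl : m = h + 1 := by omega
      have e := ih1 h 1 rfl
      rw [convQ, sub_mul, one_mul, mul_assoc (C _) X, mul_assoc (C _) (X ^ 2), coeff_sub, coeff_sub, coeff_C_mul,
        coeff_C_mul, coeff_X_mul, coeff_X_pow_mul', e, coeff_zero_convQ]
      simp [genProd]
      ring
    · obtain rfl : h = m + k := by omega
      have e0 := ih0 m k rfl
      have e1 := ih1 m (k + 1) (by ring)
      -- The splitting is `(m - 1) + (k + 2)`, with `m - 1` taken in the ring; for `m = 0` the
      -- degree bound and the binomial make both sides 0.
      have e2 : (convQ α R (m + k + 1)).coeff (k + 2) =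
          (-1) ^ (k + 2) * ((m + k + 1).choose (k + 2) : A) *
            ((R + α * (m - 1)) * (genProd k α (R + α * m) * (R + α * (m + k)))) := by
        rcases m with _ | m
        · rw [coeff_eq_zero_of_natDegree_lt ((natDegree_convQ_le _ _ _).trans_lt (by omega)),
            Nat.choose_eq_zero_of_lt (by omega)]
          simp
        · rw [ih1 m (k + 2) (by ring), genProd_succ', genProd_succ]
          push_cast
          ring_nf
      have e3 : ((m + k).choose (k + 1 + 1) : A) * (k + 2) = (m + k).choose (k + 1) * (m - 1) := by
        rcases m with _ | m
        · simp [Nat.choose_eq_zero_of_lt]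
        · have := Nat.choose_succ_right_eq (m + 1 + k) (k + 1)
          rw [show m + 1 + k - (k + 1) = m by omega] at this
          have := congrArg (Nat.cast (R := A)) this
          push_cast at this ⊢
          linear_combination this
      rw [convQ, sub_mul, one_mul, mul_assoc (C _) X, mul_assoc (C _) (X ^ 2), coeff_sub, coeff_sub, coeff_C_mul,
        coeff_C_mul, coeff_X_mul, coeff_X_pow_mul, e0, e1, e2, genProd_succ (k + 1),
        genProd_succ k,
        Nat.choose_succ_succ' (m + k + 1), Nat.choose_succ_succ' (m + k) (k + 1),
        Nat.choose_succ_succ' (m + k) k]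
      generalize genProd k α (R + α * m) = G at *
      push_cast
      linear_combination -(-1) ^ k * G * (R + α * (m + k)) * α * e3

theorem natDegree_reflQ_le (h : ℕ) (α R : A) : (reflQ h α R).natDegree ≤ h :=
  natDegree_reflect_le.trans (max_le le_rfl (natDegree_convQ_le α R h))

theorem coeff_reflQ (α R : A) (m k : ℕ) :
    (reflQ (m + k) α R).coeff m =
      (-1) ^ k * ((m + k).choose k : A) * genProd k α (R + α * m) := by
  rw [reflQ, coeff_reflect, revAt_le (Nat.le_add_right m k), Nat.add_sub_cancel_left, coeff_convQ]

theorem reflQ_ne_zero [Nontrivial A] (h : ℕ) (α R : A) : reflQ h α R ≠ 0 := by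
  intro e
  have := coeff_reflQ α R h 0
  rw [add_zero, e] at this
  simp [genProd_zero] at this

/-- The differential equation below, read coefficientwise. Beyond the degree it survives because
both sides vanish. -/
theorem coeff_succ_reflQ (h k : ℕ) (α R : A) :
    ((k : A) + 1) * (R + α * k) * (reflQ h α R).coeff (k + 1) =
      -((h : A) - k) * (reflQ h α R).coeff k := by
  rcases lt_or_ge k h with hk | hk
  · obtain ⟨j, rfl⟩ := Nat.exists_eq_add_of_lt hk
    have e1 := coeff_reflQ α R (k + 1) j
    have e0 := coeff_reflQ α R k (j + 1)
    have e := Nat.choose_succ_right_eq (k + j + 1) j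
    rw [show k + j + 1 - j = k + 1 by omega] at e
    have e := congrArg (Nat.cast (R := A)) e
    rw [show k + 1 + j = k + j + 1 by ring] at e1
    rw [← add_assoc, genProd_succ'] at e0
    rw [e0, e1]
    push_cast at e ⊢
    rw [show R + α * ((k : A) + 1) = R + α * k + α by ring]
    linear_combination -(-1) ^ j * (R + α * k) * genProd j α (R + α * k + α) * e
  · rw [coeff_eq_zero_of_natDegree_lt ((natDegree_reflQ_le h α R).trans_lt (by omega))]
    rcases hk.eq_or_lt with rfl | hk
    · simp
    · rw [coeff_eq_zero_of_natDegree_lt ((natDegree_reflQ_le h α R).trans_lt hk)]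
      simp

/-- The Laguerre differential equation. -/
theorem reflQ_differential_equation (h : ℕ) (α R : A) :
    C α * X * derivative (derivative (reflQ h α R)) + (C R - X) * derivative (reflQ h α R)
      + C (h : A) * reflQ h α R = 0 := by
  ext k
  have e := coeff_succ_reflQ h k α R
  rw [sub_mul, mul_assoc, coeff_add, coeff_add, coeff_sub, coeff_C_mul, coeff_C_mul, coeff_C_mul,
    coeff_zero]
  rcases k with _ | k
  · simp only [coeff_X_mul_zero, coeff_derivative]
    push_cast at e ⊢
    linear_combination e
  · simp only [coeff_X_mul, coeff_derivative]
    push_cast at e ⊢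
    linear_combination e

end CommRing

/-! ### Laguerre and confluent forms, simplicity of the zeros -/

section Field

variable {K : Type*} [Field K]

theorem genProd_eq_ascPochhammer {α : K} (hα : α ≠ 0) (n : ℕ) (R : K) :
    genProd n α R = α ^ n * (ascPochhammer K n).eval (R / α) := by
  induction n with
  | zero => simp [genProd_zero]
  | succ n ih =>
    rw [genProd_succ, ih, ascPochhammer_succ_eval]
    field_simp
    ring

theorem eval_reflQ (h : ℕ) {α : K} (hα : α ≠ 0) (R z : K) :
    (reflQ h α R).eval z = α ^ h * hypUNeg h (R / α) (z / α) := by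
  rw [eval_eq_sum_range' (Nat.lt_succ_of_le (natDegree_reflQ_le h α R)), hypUNeg, Finset.mul_sum,
    Finset.mul_sum]
  refine Finset.sum_congr rfl fun k hk => ?_
  obtain ⟨j, rfl⟩ := Nat.exists_eq_add_of_le (Nat.lt_succ_iff.1 (Finset.mem_range.1 hk))
  rw [coeff_reflQ, Nat.add_sub_cancel_left, genProd_eq_ascPochhammer hα, Nat.choose_symm_add,
    show (R + α * k) / α = R / α + k by field_simp]
  rw [neg_pow (z / α), div_pow, pow_add, pow_add]
  have : ((-1 : K) ^ k) * (-1) ^ k = 1 := by rw [← mul_pow]; simp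
  field_simp
  linear_combination -((k + j).choose j : K) * z ^ k *
    (ascPochhammer K j).eval ((R + α * k) / α) * this

theorem hypUNeg_eq_laguerreL [CharZero K] (h : ℕ) (b w : K) :
    hypUNeg h b w = (-1) ^ h * (h.factorial : K) * laguerreL h (b - 1) w := by
  rw [hypUNeg, laguerreL, mul_assoc, Finset.mul_sum _ _ (h.factorial : K)]
  congr 1
  refine Finset.sum_congr rfl fun k hk => ?_
  rw [Nat.cast_choose K (Nat.lt_succ_iff.1 (Finset.mem_range.1 hk)), neg_pow w,
    show b - 1 + k + 1 = b + k by ring]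
  ring

variable [CharZero K]

/-- If `q'` vanishes at `a` to order `m ≥ 1`, then in characteristic 0 `q` does so to order `m + 1`
and `q''` to order `m - 1`. The equation makes `(X - a)^m` divide `α X q''`, and `X - a` is prime to
`α X`, a contradiction. -/
theorem not_isRoot_derivative_of_differential_equation {α R c a : K} {q : K[X]} (hα : α ≠ 0)
    (ha : a ≠ 0) (hq : q ≠ 0)
    (ode : C α * X * derivative (derivative q) + (C R - X) * derivative q + C c * q = 0)
    (h0 : q.IsRoot a) : ¬ (derivative q).IsRoot a := by
  intro h1
  have hd : derivative q ≠ 0 := fun e => by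
    rw [eq_C_of_derivative_eq_zero e, IsRoot, eval_C] at h0
    rw [eq_C_of_derivative_eq_zero e, h0, map_zero] at hq
    exact hq rfl
  have hdd : derivative (derivative q) ≠ 0 := fun e => by
    rw [eq_C_of_derivative_eq_zero e, IsRoot, eval_C] at h1
    rw [eq_C_of_derivative_eq_zero e, h1, map_zero] at hd
    exact hd rfl
  have m1 := derivative_rootMultiplicity_of_root h0
  have m2 := derivative_rootMultiplicity_of_root h1
  have m3 := (rootMultiplicity_pos hd).2 h1
  set m := (derivative q).rootMultiplicity a
  have d1 : (X - C a) ^ m ∣ derivative q := pow_rootMultiplicity_dvd _ _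
  have d0 : (X - C a) ^ m ∣ q :=
    (pow_dvd_pow _ (by omega)).trans (pow_rootMultiplicity_dvd q a)
  have d2 : (X - C a) ^ m ∣ (C α * X) * derivative (derivative q) := by
    rw [show (C α * X) * derivative (derivative q) =
      -((C R - X) * derivative q + C c * q) by linear_combination ode]
    exact (dvd_add (d1.mul_left _) (d0.mul_left _)).neg_right
  have cop : IsCoprime ((X - C a) ^ m) (C α * X) := by
    refine IsCoprime.pow_left ((irreducible_X_sub_C a).coprime_iff_not_dvd.2 ?_)
    rw [dvd_iff_isRoot]
    simp [hα, ha]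
  have := (le_rootMultiplicity_iff hdd).2 (cop.dvd_of_dvd_mul_left d2)
  omega

omit [CharZero K] in
theorem genProd_ne_zero_iff (n : ℕ) (α R : K) :
    genProd n α R ≠ 0 ↔ ∀ j < n, R + (j : K) * α ≠ 0 := by
  simp [genProd, Finset.prod_ne_zero_iff, mul_comm]

theorem injective_zeros_iff {h : ℕ} {α R : K} {ℓ : Fin h → K} (hα : α ≠ 0) (hR : R ≠ 0)
    (hℓ : IsZeroOrdering h α R ℓ) :
    Function.Injective ℓ ↔ ∀ j : ℕ, 1 ≤ j → j < h → R + (j : K) * α ≠ 0 := by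
  constructor
  · intro inj j hj1 hjh e
    -- The vanishing factor `R + jα` occurs in every coefficient of index at most `j`; as `j ≥ 1`, 0
    -- is a double zero.
    have hv : ∀ k ≤ j, (reflQ h α R).coeff k = 0 := by
      intro k hk
      obtain ⟨i, rfl⟩ := Nat.exists_eq_add_of_le (hk.trans hjh.le)
      rw [coeff_reflQ]
      have : genProd i α (R + α * k) = 0 := by
        refine Finset.prod_eq_zero (i := j - k) (Finset.mem_range.2 (by omega)) ?_
        rw [Nat.cast_sub hk]
        linear_combination e
      rw [this, mul_zero]
    have hd : X ^ 2 ∣ reflQ h α R := by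
      rw [X_pow_dvd_iff]
      exact fun d hd => hv d (by omega)
    have hsep : Squarefree (reflQ h α R) := by
      rw [hℓ]
      exact (separable_prod_X_sub_C_iff.2 inj).squarefree
    exact not_isUnit_X (hsep X (by rwa [← sq]))
  · intro hne i j hij
    by_contra hij'
    have hd : (X - C (ℓ i)) ^ 2 ∣ reflQ h α R := by
      rw [hℓ, sq]
      nth_rewrite 2 [hij]
      rw [← Finset.mul_prod_erase Finset.univ _ (Finset.mem_univ i)]
      exact mul_dvd_mul_left _ (Finset.dvd_prod_of_mem _ (by simp [Ne.symm hij']))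
    have h0 : (reflQ h α R).IsRoot (ℓ i) :=
      dvd_iff_isRoot.1 ((dvd_pow_self _ two_ne_zero).trans hd)
    have hne0 := reflQ_ne_zero h α R
    have h1 : (derivative (reflQ h α R)).IsRoot (ℓ i) :=
      ((one_lt_rootMultiplicity_iff_isRoot hne0).1 ((le_rootMultiplicity_iff hne0).2 hd)).2
    refine not_isRoot_derivative_of_differential_equation hα ?_ hne0
      (reflQ_differential_equation h α R) h0 h1
    -- The zero 0 escapes the differential equation; it is excluded by the constant term `±p_h(α,
    -- R)`, and here `R ≠ 0` enters.
    intro hz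
    rw [hz, IsRoot, ← coeff_zero_eq_eval_zero] at h0
    have e := coeff_reflQ α R 0 h
    rw [zero_add, h0, Nat.choose_self, Nat.cast_zero, mul_zero, add_zero] at e
    have hg : genProd h α R ≠ 0 := by
      rw [genProd_ne_zero_iff]
      intro k hk
      rcases k with _ | k
      · simpa using hR
      · exact hne _ (by omega) hk
    simp [hg] at e

end Field

/-! ### Reversal, partial fractions and the sum over zeros -/

section CommRing

variable {A ι : Type*} [CommRing A]

theorem natDegree_prod_one_sub_le (s : Finset ι) (ℓ : ι → A) :
    (∏ i ∈ s, (1 - C (ℓ i) * X)).natDegree ≤ s.card := by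
  refine (natDegree_prod_le _ _).trans ((Finset.sum_le_card_nsmul _ _ 1 fun i _ => ?_).trans ?_)
  · show (1 - C (ℓ i) * X).natDegree ≤ 1
    compute_degree
  · simp

/-- Reversal is taken at the nominal degree `s.card`, so a factor with `ℓ i = 0` correctly becomes
`X`. -/
theorem reflect_prod_one_sub (s : Finset ι) (ℓ : ι → A) :
    (∏ i ∈ s, (1 - C (ℓ i) * X)).reflect s.card = ∏ i ∈ s, (X - C (ℓ i)) := by
  classical
  induction s using Finset.induction_on with
  | empty => simp
  | insert a s ha ih =>
    have h1 : (1 - C (ℓ a) * X : A[X]).natDegree ≤ 1 := by compute_degree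
    rw [Finset.prod_insert ha, Finset.prod_insert ha, Finset.card_insert_of_notMem ha, add_comm,
      reflect_mul _ _ h1 (natDegree_prod_one_sub_le s ℓ), ih, reflect_sub, reflect_C_mul,
      reflect_one, reflect_one_X, pow_one, mul_one]

theorem reflect_sum (N : ℕ) (s : Finset ι) (f : ι → A[X]) :
    (∑ i ∈ s, f i).reflect N = ∑ i ∈ s, (f i).reflect N := by
  ext n
  simp [coeff_reflect]

theorem mk_pow_mul_one_sub (r : A) :
    PowerSeries.mk (fun n => r ^ n) * (1 - PowerSeries.C r * PowerSeries.X) = 1 := by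
  ext n
  rcases n with _ | n
  · simp [mul_sub]
  · rw [mul_sub, mul_left_comm, map_sub, mul_one, PowerSeries.coeff_C_mul,
      PowerSeries.coeff_succ_mul_X]
    simp [PowerSeries.coeff_one, pow_succ']

end CommRing

section Field

variable {K : Type*} [Field K] {h : ℕ} {α R : K} {ℓ : Fin h → K}

theorem IsZeroOrdering.convQ_eq (hℓ : IsZeroOrdering h α R ℓ) :
    convQ α R h = ∏ i, (1 - C (ℓ i) * X) := by
  have e := reflect_prod_one_sub Finset.univ ℓ
  rw [Finset.card_fin, ← hℓ, reflQ] at e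
  rw [← reflect_reflect (N := h) (p := convQ α R h), ← e, reflect_reflect]

theorem one_sub_C_mul_X_ne_zero (r : K) : (1 - C r * X : K[X]) ≠ 0 := by
  intro e
  simpa using congrArg (eval 0) e

theorem isPartialFractionCoeffs_iff (hℓ : IsZeroOrdering h α R ℓ) (c : Fin h → K) :
    IsPartialFractionCoeffs h α R ℓ c ↔
      convP α R h = ∑ j, C (c j) * ∏ i ∈ Finset.univ.erase j, (1 - C (ℓ i) * X) := by
  have hne : ∀ r : K, (1 - RatFunc.C r * RatFunc.X : RatFunc K) ≠ 0 := fun r e => by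
    refine one_sub_C_mul_X_ne_zero r (RatFunc.algebraMap_injective K ?_)
    simpa using e
  have hQ : algebraMap K[X] (RatFunc K) (convQ α R h) =
      ∏ i, (1 - RatFunc.C (ℓ i) * RatFunc.X) := by
    simp [hℓ.convQ_eq, map_prod]
  have hQ0 : algebraMap K[X] (RatFunc K) (convQ α R h) ≠ 0 := by
    rw [hQ]
    exact Finset.prod_ne_zero_iff.2 fun i _ => hne _
  rw [IsPartialFractionCoeffs, conv, div_eq_iff hQ0, ← (RatFunc.algebraMap_injective K).eq_iff,
    hQ, Finset.sum_mul, map_sum]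
  refine Eq.congr_right (Finset.sum_congr rfl fun j _ => ?_)
  rw [← Finset.mul_prod_erase _ _ (Finset.mem_univ j), div_mul_eq_mul_div, mul_left_comm,
    mul_div_cancel_left₀ _ (hne _)]
  simp [map_prod]

theorem convP_eq_sum_iff (c : Fin h → K) :
    convP α R h = ∑ j, C (c j) * ∏ i ∈ Finset.univ.erase j, (1 - C (ℓ i) * X) ↔
      reflP h α R = ∑ j, C (c j) * ∏ i ∈ Finset.univ.erase j, (X - C (ℓ i)) := by
  have e : (∑ j, C (c j) * ∏ i ∈ Finset.univ.erase j, (1 - C (ℓ i) * X)).reflect (h - 1) =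
      ∑ j, C (c j) * ∏ i ∈ Finset.univ.erase j, (X - C (ℓ i)) := by
    rw [reflect_sum]
    refine Finset.sum_congr rfl fun j _ => ?_
    have := reflect_prod_one_sub (Finset.univ.erase j) ℓ
    rw [Finset.card_erase_of_mem (Finset.mem_univ j), Finset.card_fin] at this
    rw [reflect_C_mul, this]
  rw [← e, reflP]
  refine ⟨fun H => by rw [H], fun H => ?_⟩
  rw [← reflect_reflect (N := h - 1) (p := convP α R h), H, reflect_reflect]

theorem eval_sum_prod_erase (c : Fin h → K) (i : Fin h) :
    (∑ j, C (c j) * ∏ k ∈ Finset.univ.erase j, (X - C (ℓ k))).eval (ℓ i) =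
      c i * ∏ j ∈ Finset.univ.erase i, (ℓ i - ℓ j) := by
  rw [eval_finsetSum, Finset.sum_eq_single i]
  · simp [eval_prod]
  · intro j _ hj
    rw [eval_mul, eval_prod, Finset.prod_eq_zero (i := i) (by simp [hj.symm]) (by simp), mul_zero]
  · simp

/-- Lagrange interpolation: both sides have degree below `h`, and at the node `ℓ i` only the `i`-th
summand survives. -/
theorem reflP_eq_sum_iff (hh : 1 ≤ h) (inj : Function.Injective ℓ) (c : Fin h → K) :
    reflP h α R = ∑ j, C (c j) * ∏ i ∈ Finset.univ.erase j, (X - C (ℓ i)) ↔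
      ∀ i, c i = zeroCoeff h α R ℓ i := by
  have hne : ∀ i, ∏ j ∈ Finset.univ.erase i, (ℓ i - ℓ j) ≠ 0 := fun i =>
    Finset.prod_ne_zero_iff.2 fun j hj =>
      sub_ne_zero.2 (inj.ne (Finset.ne_of_mem_erase hj).symm)
  constructor
  · intro e i
    rw [zeroCoeff, e, eval_sum_prod_erase, mul_div_cancel_right₀ _ (hne i)]
  · intro hc
    have lt : ∀ p : K[X], p.natDegree ≤ h - 1 →
        p.degree < ((Finset.univ : Finset (Fin h)).card : WithBot ℕ) := fun p hp => by
      rw [Finset.card_fin]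
      refine (degree_le_of_natDegree_le hp).trans_lt ?_
      exact_mod_cast (by omega : h - 1 < h)
    refine Polynomial.eq_of_degrees_lt_of_eval_index_eq Finset.univ inj.injOn (lt _ ?_) (lt _ ?_)
      fun i _ => ?_
    · obtain ⟨k, rfl⟩ := Nat.exists_eq_add_of_le' hh
      exact natDegree_reflect_le.trans (max_le le_rfl (natDegree_convP_succ_le α R k))
    · refine natDegree_sum_le_of_forall_le _ _ fun j _ => (natDegree_C_mul_le _ _).trans ?_
      refine (natDegree_prod_le _ _).trans (le_of_eq ?_)
      simp
    · rw [eval_sum_prod_erase, hc, zeroCoeff, div_mul_cancel₀ _ (hne i)]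

theorem zeroSum_eq_coeff_convSeries (hh : 1 ≤ h) (hℓ : IsZeroOrdering h α R ℓ)
    (inj : Function.Injective ℓ) (N : ℕ) :
    zeroSum h α R ℓ N = PowerSeries.coeff N (convSeries h α R) := by
  have e := (convP_eq_sum_iff (α := α) (R := R) (zeroCoeff h α R ℓ)).2
    ((reflP_eq_sum_iff hh inj _).2 fun i => rfl)
  have e2 : ∑ i, PowerSeries.C (zeroCoeff h α R ℓ i) * PowerSeries.mk (fun n => ℓ i ^ n) =
      convSeries h α R := by
    rw [eq_convSeries_iff, e, hℓ.convQ_eq, Finset.mul_sum, ← coeToPowerSeries.ringHom_apply,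
      ← coeToPowerSeries.ringHom_apply, map_sum]
    refine Finset.sum_congr rfl fun j _ => ?_
    rw [← Finset.mul_prod_erase _ _ (Finset.mem_univ j), map_mul, map_mul]
    simp only [coeToPowerSeries.ringHom_apply, coe_sub, coe_mul, coe_one, coe_C, coe_X]
    linear_combination PowerSeries.C (zeroCoeff h α R ℓ j) *
      ((∏ i ∈ Finset.univ.erase j, (1 - C (ℓ i) * X) : K[X]) : PowerSeries K) *
        mk_pow_mul_one_sub (ℓ j)
  rw [← e2, map_sum]
  simp [zeroSum, PowerSeries.coeff_C_mul]

/-- A transcendental `x` never satisfies `x + m = 0` with `m` an integer, so the distinctness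
criterion is automatic. -/
theorem IsZeroOrdering.injective_of_transcendental [CharZero K] {a : ℤ} {x : K} (ha : a ≠ 0)
    (hx : Transcendental ℤ x) (hℓ : IsZeroOrdering h (a : K) x ℓ) : Function.Injective ℓ := by
  have hne : ∀ m : ℤ, x + m ≠ 0 := fun m e => hx ⟨X + C m, X_add_C_ne_zero m, by simpa using e⟩
  refine (injective_zeros_iff (by exact_mod_cast ha) (by simpa using hne 0) hℓ).2 fun j _ _ => ?_
  simpa using hne (j * a)

end Field

/-! ### Symbolic parameter and transfer to `α`-factorials -/

section Symbolic

/-- The `n`-th coefficient of the convergent `P_h / Q_h`, as a polynomial in `R`. -/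
def symbolicSum (h n : ℕ) (a : ℤ) : ℤ[X] :=
  PowerSeries.coeff n (convSeries h (C a) (X : ℤ[X]))

theorem aeval_symbolicSum {K : Type*} [Field K] (h n : ℕ) (a : ℤ) (x : K) :
    aeval x (symbolicSum h n a) = PowerSeries.coeff n (convSeries h (a : K) x) := by
  have := map_coeff_convSeries (aeval x : ℤ[X] →ₐ[ℤ] K).toRingHom h n (C a) X
  simpa [symbolicSum] using this

theorem eval_symbolicSum (h n : ℕ) (a r : ℤ) :
    (symbolicSum h n a).eval r = PowerSeries.coeff n (convSeries h a r) := by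
  have := map_coeff_convSeries (evalRingHom r) h n (C a) X
  simpa [symbolicSum] using this

end Symbolic

theorem genProd_modEq_coeff_convSeries {h i : ℕ} (hh : 1 ≤ h) (hi : i ≤ h) (n : ℕ) (a r : ℤ) :
    genProd n a r ≡ PowerSeries.coeff n (convSeries h a r) [ZMOD (h : ℤ) * a ^ i] := by
  rw [Int.modEq_comm, Int.modEq_iff_dvd]
  exact mul_pow_dvd_genProd_sub hh hi n a r

theorem modEq_mul_neg_pow_iff {a b m c : ℤ} (i : ℕ) :
    a ≡ b [ZMOD m * (-c) ^ i] ↔ a ≡ b [ZMOD m * c ^ i] := by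
  rcases Nat.even_or_odd i with e | e <;> simp [e.neg_pow, Int.modEq_iff_dvd]

theorem intCast_alphaFactorial {K : Type*} [Field K] {α n : ℕ} (hα : 1 ≤ α) (hn : 1 ≤ n) :
    ((alphaFactorial α n : ℤ) : K) = genProd ((n - 1) / α + 1) (-(α : K)) (n : K) := by
  rw [alphaFactorial_eq_genProd hα hn]
  simpa using map_genProd (Int.castRingHom K) ((n - 1) / α + 1) (-(α : ℤ)) (n : ℤ)

end GenFact

end

theorem mainTheorem7 {K : Type*} [Field K] [CharZero K] :
    -- the zeros of the reflected denominator are the Laguerre and the confluent `U` zeros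
    (∀ (h : ℕ) (α R : K), 1 ≤ h → α ≠ 0 → R ≠ 0 → ∀ z : K,
      (GenFact.reflQ h α R).eval z = α ^ h * GenFact.hypUNeg h (R / α) (z / α) ∧
      (GenFact.reflQ h α R).eval z =
        (-α) ^ h * (h.factorial : K) * GenFact.laguerreL h (R / α - 1) (z / α)) ∧
    -- when the zeros are distinct, and the partial fraction coefficients in that case
    (∀ (h : ℕ) (α R : K) (ℓ : Fin h → K), 1 ≤ h → α ≠ 0 → R ≠ 0 →
      GenFact.IsZeroOrdering h α R ℓ →
      (Function.Injective ℓ ↔ ∀ j : ℕ, 1 ≤ j → j < h → R + (j : K) * α ≠ 0) ∧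
      (Function.Injective ℓ → ∀ c : Fin h → K,
        GenFact.IsPartialFractionCoeffs h α R ℓ c ↔ ∀ i, c i = GenFact.zeroCoeff h α R ℓ i)) ∧
    -- exact formula for the generalized products
    (∀ (h n : ℕ) (α R : K) (ℓ : Fin h → K), α ≠ 0 → R ≠ 0 →
      GenFact.IsZeroOrdering h α R ℓ → Function.Injective ℓ → 1 ≤ n → n ≤ h →
      GenFact.genProd n α R = GenFact.zeroSum h α R ℓ n) ∧
    -- congruences for the generalized products, in any subring `A` containing `α` and `R`
    (∀ (A : Subring K) (p n : ℕ) (α R : K) (ℓ : Fin p → K), α ∈ A → R ∈ A → α ≠ 0 → R ≠ 0 →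
      GenFact.IsZeroOrdering p α R ℓ → Function.Injective ℓ → 2 ≤ p → 1 ≤ n →
      GenFact.zeroSum p α R ℓ n ∈ A ∧
      ∀ i : ℕ, i ≤ p → ∃ q ∈ A,
        GenFact.genProd n α R - GenFact.zeroSum p α R ℓ n = (p : K) * α ^ i * q) ∧
    -- exact formula for the `α`-factorial function
    (∀ (h n α : ℕ) (ℓ : Fin h → K), 1 ≤ α →
      GenFact.IsZeroOrdering h (-(α : K)) (n : K) ℓ → Function.Injective ℓ → 1 ≤ n → n ≤ h →
      (GenFact.alphaFactorial α (n : ℤ) : K) =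
        GenFact.zeroSum h (-(α : K)) (n : K) ℓ ((n - 1) / α + 1)) ∧
    -- congruences for the `α`-factorial function
    (∀ (p n α : ℕ) (ℓ : Fin p → K), 1 ≤ α →
      GenFact.IsZeroOrdering p (-(α : K)) (n : K) ℓ → Function.Injective ℓ → 2 ≤ p → 1 ≤ n →
      ∃ s : ℤ, (s : K) = GenFact.zeroSum p (-(α : K)) (n : K) ℓ ((n - 1) / α + 1) ∧
        ∀ i : ℕ, i ≤ p → GenFact.alphaFactorial α (n : ℤ) ≡ s [ZMOD (p : ℤ) * (α : ℤ) ^ i]) ∧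
    -- both pairs with `R` a symbolic indeterminate `x` that is specialized after the summation,
    -- which needs no condition on the zeros at the specialized value
    (∀ (h n : ℕ) (α : ℤ) (x : K) (ℓ : Fin h → K), 1 ≤ h → 1 ≤ n → α ≠ 0 → Transcendental ℤ x →
      GenFact.IsZeroOrdering h (α : K) x ℓ →
      ∃ s : Polynomial ℤ,
        Polynomial.aeval x s = GenFact.zeroSum h (α : K) x ℓ n ∧
        ∀ R : ℤ,
          (n ≤ h → GenFact.genProd n α R = s.eval R) ∧
          (2 ≤ h → ∀ i : ℕ, i ≤ h → GenFact.genProd n α R ≡ s.eval R [ZMOD (h : ℤ) * α ^ i])) ∧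
    (∀ (h n α : ℕ) (x : K) (ℓ : Fin h → K), 1 ≤ h → 1 ≤ n → 1 ≤ α → Transcendental ℤ x →
      GenFact.IsZeroOrdering h (-(α : K)) x ℓ →
      ∃ s : Polynomial ℤ,
        Polynomial.aeval x s = GenFact.zeroSum h (-(α : K)) x ℓ ((n - 1) / α + 1) ∧
        (n ≤ h → GenFact.alphaFactorial α (n : ℤ) = s.eval (n : ℤ)) ∧
        (2 ≤ h → ∀ i : ℕ, i ≤ h →
          GenFact.alphaFactorial α (n : ℤ) ≡ s.eval (n : ℤ) [ZMOD (h : ℤ) * (α : ℤ) ^ i])) := by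
  refine ⟨fun h α R _ hα _ z => ⟨GenFact.eval_reflQ h hα R z, ?_⟩,
    fun h α R ℓ hh hα hR hℓ => ⟨GenFact.injective_zeros_iff hα hR hℓ, fun inj c => ?_⟩,
    fun h n α R ℓ _ _ hℓ inj hn hnh => ?_, fun A p n α R ℓ hαA hRA _ _ hℓ inj hp _ => ?_,
    fun h n α ℓ hα hℓ inj hn hnh => ?_, fun p n α ℓ hα hℓ inj hp hn => ?_,
    fun h n α x ℓ hh hn hα hx hℓ => ?_, fun h n α x ℓ hh hn hα hx hℓ => ?_⟩
  · rw [GenFact.eval_reflQ h hα, GenFact.hypUNeg_eq_laguerreL, neg_pow α]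
    ring
  · rw [GenFact.isPartialFractionCoeffs_iff hℓ, GenFact.convP_eq_sum_iff,
      GenFact.reflP_eq_sum_iff hh inj]
  · rw [GenFact.zeroSum_eq_coeff_convSeries (by omega) hℓ inj,
      GenFact.genProd_eq_coeff_convSeries (h := h) (by omega)]
  -- The coefficient is formed in the ring `A` itself, so that both membership and the quotient `q`
  -- come from `A`.
  · have e := GenFact.map_coeff_convSeries A.subtype p n ⟨α, hαA⟩ ⟨R, hRA⟩
    rw [GenFact.zeroSum_eq_coeff_convSeries (by omega) hℓ inj]
    simp only [Subring.subtype_apply] at e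
    refine ⟨e ▸ Subtype.property _, fun i hi => ?_⟩
    obtain ⟨q, hq⟩ := GenFact.mul_pow_dvd_genProd_sub (by omega : 1 ≤ p) hi n
      (⟨α, hαA⟩ : A) ⟨R, hRA⟩
    refine ⟨q, q.2, ?_⟩
    have e2 := congrArg A.subtype hq
    rw [map_sub, GenFact.map_genProd, map_mul, map_mul, map_pow, map_natCast] at e2
    simpa [e] using e2
  -- This gives `N ≤ n ≤ h < 2h`, the range of exactness.
  · have hN : (n - 1) / α ≤ n - 1 := Nat.div_le_self _ _
    rw [GenFact.intCast_alphaFactorial hα hn,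
      GenFact.zeroSum_eq_coeff_convSeries (by omega) hℓ inj,
      GenFact.genProd_eq_coeff_convSeries (h := h) (by omega)]
  · refine ⟨PowerSeries.coeff ((n - 1) / α + 1) (GenFact.convSeries p (-(α : ℤ)) (n : ℤ)), ?_,
      fun i hi => ?_⟩
    · rw [GenFact.zeroSum_eq_coeff_convSeries (by omega) hℓ inj]
      simpa using GenFact.map_coeff_convSeries (Int.castRingHom K) p ((n - 1) / α + 1)
        (-(α : ℤ)) (n : ℤ)
    · rw [GenFact.alphaFactorial_eq_genProd hα hn, ← GenFact.modEq_mul_neg_pow_iff]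
      exact GenFact.genProd_modEq_coeff_convSeries (by omega) hi _ _ _
  · refine ⟨GenFact.symbolicSum h n α, ?_, fun R => ⟨fun hnh => ?_, fun _ i hi => ?_⟩⟩
    · rw [GenFact.aeval_symbolicSum,
        GenFact.zeroSum_eq_coeff_convSeries hh hℓ (hℓ.injective_of_transcendental hα hx)]
    · rw [GenFact.eval_symbolicSum, GenFact.genProd_eq_coeff_convSeries (h := h) (by omega)]
    · rw [GenFact.eval_symbolicSum]
      exact GenFact.genProd_modEq_coeff_convSeries hh hi _ _ _
  · have hN : (n - 1) / α ≤ n - 1 := Nat.div_le_self _ _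
    have hc : -(α : K) = ((-(α : ℤ) : ℤ) : K) := by push_cast; rfl
    rw [hc] at hℓ ⊢
    refine ⟨GenFact.symbolicSum h ((n - 1) / α + 1) (-(α : ℤ)), ?_, fun hnh => ?_,
      fun _ i hi => ?_⟩
    · rw [GenFact.aeval_symbolicSum, GenFact.zeroSum_eq_coeff_convSeries hh hℓ
        (hℓ.injective_of_transcendental (by omega) hx)]
    · rw [GenFact.eval_symbolicSum, GenFact.alphaFactorial_eq_genProd hα hn,
        GenFact.genProd_eq_coeff_convSeries (h := h) (by omega)]
    · rw [GenFact.eval_symbolicSum, GenFact.alphaFactorial_eq_genProd hα hn,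
        ← GenFact.modEq_mul_neg_pow_iff]
      exact GenFact.genProd_modEq_coeff_convSeries hh hi _ _ _
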